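/- Let $n \ge 0$ and let $\langle\cdot,\cdot\rangle$ be the $\mathbb C$-bilinear extension to $\mathbb C^{3+n}=\mathbb R^{3,n}\otimes\mathbb C$ of the standard symmetric bilinear form of signature $(3,n)$ on $\mathbb R^{3,n}$. Let $$\mathrm{Per} = \mathrm{Gr}_{++}(\mathbb R^{3,n}) = \{[v]\in\mathbb P(\mathbb C^{3+n}) : \langle v,v\rangle = 0,\ \langle v,\bar v\rangle > 0\}$$ be the period space, a complex manifold of dimension $n+1$, being an open subset of the smooth quadric $\{\langle v,v\rangle=0\}\subset\mathbb P(\mathbb C^{3+n})$. Then $\mathrm{Per}$ contains no compact complex submanifold of dimension greater than $1$: if a nonempty compact complex manifold $X$ of (pure) dimension $d$ admits a holomorphic embedding (a holomorphic immersion that is a homeomorphism onto its image) $X\to\mathrm{Per}$, then $d\le 1$. -/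

import Mathlib

open scoped Manifold ContDiff Topology LinearAlgebra.Projectivization

noncomputable section

/-- The quotient topology on the projective space of a topological vector space. -/
instance Projectivization.instTopologicalSpace {K V : Type*} [DivisionRing K] [AddCommGroup V]
    [Module K V] [TopologicalSpace V] : TopologicalSpace (ℙ K V) :=
  TopologicalSpace.coinduced (Projectivization.mk' K) inferInstance

namespace PeriodSpace

/-- The complexification `ℂ^{3+n}` of `ℝ^{3,n}`; the first three coordinates are the positive
directions. Complex conjugation is `star`. -/
abbrev CVec (n : ℕ) : Type := Fin 3 ⊕ Fin n → ℂ

/-- The `ℂ`-bilinear extension of the standard symmetric form of signature `(3, n)`. -/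
def form (n : ℕ) : LinearMap.BilinForm ℂ (CVec n) :=
  LinearMap.mk₂ ℂ
    (fun v w => ∑ i : Fin 3, v (Sum.inl i) * w (Sum.inl i)
      - ∑ j : Fin n, v (Sum.inr j) * w (Sum.inr j))
    (fun a b c => by simp only [Pi.add_apply, add_mul, Finset.sum_add_distrib]; ring)
    (fun t a b => by
      simp only [Pi.smul_apply, smul_eq_mul, mul_assoc, ← Finset.mul_sum]; ring)
    (fun a b c => by simp only [Pi.add_apply, mul_add, Finset.sum_add_distrib]; ring)
    (fun t a b => by
      simp only [Pi.smul_apply, smul_eq_mul, mul_left_comm _ t, ← Finset.mul_sum]; ring)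

variable {n : ℕ}

theorem form_apply (v w : CVec n) :
    form n v w = ∑ i : Fin 3, v (Sum.inl i) * w (Sum.inl i)
      - ∑ j : Fin n, v (Sum.inr j) * w (Sum.inr j) := rfl

theorem form_comm (v w : CVec n) : form n v w = form n w v := by
  simp only [form_apply, mul_comm]

theorem form_star (v w : CVec n) : form n (star v) (star w) = star (form n v w) := by
  simp [form_apply]

/-- Positive null vectors: `⟨v, v⟩ = 0` and `⟨v, v̄⟩ > 0`
(`⟨v, v̄⟩` is automatically a real number). -/
def IsPosNull (v : CVec n) : Prop :=
  form n v v = 0 ∧ 0 < (form n v (star v)).re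

theorem IsPosNull.ne_zero {v : CVec n} (h : IsPosNull v) : v ≠ 0 := by
  rintro rfl
  simpa using h.2

theorem IsPosNull.smul {v : CVec n} (h : IsPosNull v) {t : ℂ} (ht : t ≠ 0) :
    IsPosNull (t • v) := by
  refine ⟨by simp [h.1], ?_⟩
  have h2 : form n (t • v) (star (t • v)) = ((Complex.normSq t : ℝ) : ℂ) * form n v (star v) := by
    rw [star_smul, LinearMap.map_smul₂, map_smul, smul_eq_mul, smul_eq_mul, ← mul_assoc,
      ← Complex.mul_conj]
    rfl
  rw [h2, Complex.re_ofReal_mul]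
  exact mul_pos (Complex.normSq_pos.2 ht) h.2

end PeriodSpace

open PeriodSpace

/-- The period space `Gr₊₊(ℝ^{3,n})`: the set of lines in `ℂ^{3+n}` spanned by positive null
vectors, with the topology induced from the projective space. -/
def PeriodSpace (n : ℕ) : Type :=
  {p : ℙ ℂ (CVec n) // IsPosNull p.rep}

namespace PeriodSpace

variable {n : ℕ}

instance : TopologicalSpace (PeriodSpace n) :=
  inferInstanceAs (TopologicalSpace {p : ℙ ℂ (CVec n) // IsPosNull p.rep})

theorem isPosNull_rep_mk {v : CVec n} (hv : v ≠ 0) :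
    IsPosNull (Projectivization.mk ℂ v hv).rep ↔ IsPosNull v := by
  obtain ⟨a, ha⟩ := Projectivization.exists_smul_eq_mk_rep ℂ v hv
  rw [← ha]
  refine ⟨fun h => ?_, fun h => h.smul a.ne_zero⟩
  have := h.smul (t := ((a⁻¹ : ℂˣ) : ℂ)) (a⁻¹).ne_zero
  rwa [show ((a⁻¹ : ℂˣ) : ℂ) • (a • v) = a⁻¹ • a • v from rfl, inv_smul_smul] at this

/-- The point of the period space spanned by a positive null vector. -/
def mk (v : CVec n) (hv : IsPosNull v) : PeriodSpace n :=
  ⟨Projectivization.mk ℂ v hv.ne_zero, (isPosNull_rep_mk hv.ne_zero).2 hv⟩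

/-- A positive null vector spanning the given line. -/
def rep (p : PeriodSpace n) : CVec n := p.1.rep

theorem isPosNull_rep (p : PeriodSpace n) : IsPosNull p.rep := p.2

theorem mk_rep (p : PeriodSpace n) : mk p.rep p.isPosNull_rep = p :=
  Subtype.ext p.1.mk_rep

theorem exists_rep_mk (v : CVec n) (hv : IsPosNull v) :
    ∃ a : ℂ, a ≠ 0 ∧ (mk v hv).rep = a • v := by
  obtain ⟨a, ha⟩ := Projectivization.exists_smul_eq_mk_rep ℂ v hv.ne_zero
  exact ⟨a, a.ne_zero, ha.symm⟩

theorem mk_eq_mk {v w : CVec n} (hv : IsPosNull v) (hw : IsPosNull w) {a : ℂ} (h : a • w = v) :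
    mk v hv = mk w hw :=
  Subtype.ext ((Projectivization.mk_eq_mk_iff' ℂ v w hv.ne_zero hw.ne_zero).2 ⟨a, h⟩)

theorem isOpenQuotientMap_mk' :
    IsOpenQuotientMap (Projectivization.mk' ℂ : {v : CVec n // v ≠ 0} → ℙ ℂ (CVec n)) := by
  refine ⟨fun p => ⟨⟨p.rep, p.rep_nonzero⟩, p.mk_rep⟩, continuous_coinduced_rng, fun U hU => ?_⟩
  change IsOpen (Projectivization.mk' ℂ ⁻¹' (Projectivization.mk' ℂ '' U))
  have : (Projectivization.mk' ℂ : {v : CVec n // v ≠ 0} → ℙ ℂ (CVec n)) ⁻¹'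
      (Projectivization.mk' ℂ '' U) =
      ⋃ a : ℂˣ, (fun v : {v : CVec n // v ≠ 0} =>
        (⟨a • v.1, (smul_ne_zero_iff_ne a).2 v.2⟩ : {v : CVec n // v ≠ 0})) ⁻¹' U := by
    ext v
    simp only [Set.mem_preimage, Set.mem_image, Set.mem_iUnion]
    constructor
    · rintro ⟨w, hw, h⟩
      obtain ⟨a, ha⟩ := (Projectivization.mk_eq_mk_iff ℂ _ _ w.2 v.2).1 h
      refine ⟨a, ?_⟩
      convert hw using 1
      exact Subtype.ext ha
    · rintro ⟨a, ha⟩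
      exact ⟨_, ha, (Projectivization.mk_eq_mk_iff ℂ _ _ _ v.2).2 ⟨a, rfl⟩⟩
  rw [this]
  refine isOpen_iUnion fun a => hU.preimage ?_
  exact Continuous.subtype_mk (continuous_subtype_val.const_smul a) _

/-- For a positive null vector `w`, coordinates `S` on the orthogonal complement of `w` and `w̄`
and the corresponding coordinates `T` of the orthogonal projection to it. -/
theorem exists_coords (w : CVec n) (hw : IsPosNull w) :
    ∃ (S : EuclideanSpace ℂ (Fin (n + 1)) →L[ℂ] CVec n)
      (T : CVec n →L[ℂ] EuclideanSpace ℂ (Fin (n + 1))),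
      (∀ e, T (S e) = e) ∧ (∀ e, form n (S e) w = 0) ∧ (∀ e, form n (S e) (star w) = 0) ∧
      ∀ v, v = (form n v (star w) / form n w (star w)) • w
        + (form n v w / form n w (star w)) • star w + S (T v) := by
  set c := form n w (star w) with hc
  have hc0 : c ≠ 0 := fun h => by
    have := hw.2
    rw [← hc, h] at this
    simp at this
  have hc' : form n (star w) w = c := by rw [form_comm]
  have hs : form n (star w) (star w) = 0 := by rw [form_star, hw.1, star_zero]
  let f : CVec n →ₗ[ℂ] ℂ × ℂ := ((form n).flip w).prod ((form n).flip (star w))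
  have hf : ∀ v, f v = (form n v w, form n v (star w)) := fun v => rfl
  have hsurj : LinearMap.range f = ⊤ := by
    rw [LinearMap.range_eq_top]
    rintro ⟨a, b⟩
    refine ⟨(b / c) • w + (a / c) • star w, ?_⟩
    rw [hf]
    simp only [map_add, map_smul, LinearMap.add_apply, LinearMap.smul_apply, smul_eq_mul, hw.1, hs,
      hc', ← hc, mul_zero, zero_add, add_zero, div_mul_cancel₀ _ hc0]
  have hrank : Module.finrank ℂ (LinearMap.ker f) = n + 1 := by
    have h1 := LinearMap.finrank_range_add_finrank_ker f
    rw [hsurj, finrank_top, Module.finrank_prod, Module.finrank_self, Module.finrank_pi,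
      Fintype.card_sum, Fintype.card_fin, Fintype.card_fin] at h1
    omega
  let L : EuclideanSpace ℂ (Fin (n + 1)) ≃ₗ[ℂ] LinearMap.ker f :=
    LinearEquiv.ofFinrankEq _ _ (by rw [finrank_euclideanSpace_fin, hrank])
  let P₀ : CVec n →ₗ[ℂ] CVec n := LinearMap.id
    - (c⁻¹ • ((form n).flip (star w))).smulRight w - (c⁻¹ • ((form n).flip w)).smulRight (star w)
  have hP₀ : ∀ v, P₀ v = v - (c⁻¹ * form n v (star w)) • w - (c⁻¹ * form n v w) • star w :=
    fun v => rfl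
  have hP₀mem : ∀ v, P₀ v ∈ LinearMap.ker f := by
    intro v
    rw [LinearMap.mem_ker, hf, hP₀]
    simp only [map_sub, map_smul, LinearMap.sub_apply, LinearMap.smul_apply, smul_eq_mul, hw.1, hs,
      hc', ← hc, mul_zero, sub_zero]
    ext <;> simp <;> field_simp <;> ring
  let P : CVec n →ₗ[ℂ] LinearMap.ker f := P₀.codRestrict _ hP₀mem
  have hker : ∀ e, form n (L e : CVec n) w = 0 ∧ form n (L e : CVec n) (star w) = 0 := by
    intro e
    have := (L e).2
    rw [LinearMap.mem_ker, hf, Prod.mk_eq_zero] at this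
    exact this
  refine ⟨LinearMap.toContinuousLinearMap ((LinearMap.ker f).subtype ∘ₗ L.toLinearMap),
    LinearMap.toContinuousLinearMap (L.symm.toLinearMap ∘ₗ P), ?_, ?_, ?_, ?_⟩
  · intro e
    have : P (L e : CVec n) = L e := by
      apply Subtype.ext
      change P₀ (L e : CVec n) = _
      rw [hP₀, (hker e).1, (hker e).2]
      simp
    simp [this]
  · exact fun e => (hker e).1
  · exact fun e => (hker e).2
  · intro v
    have : (LinearMap.toContinuousLinearMap ((LinearMap.ker f).subtype ∘ₗ L.toLinearMap))
        ((LinearMap.toContinuousLinearMap (L.symm.toLinearMap ∘ₗ P)) v) = P₀ v := by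
      simp [P]
    rw [this, hP₀, div_eq_inv_mul, div_eq_inv_mul]
    abel

/-- Linear coordinates `ℂ^{n+1} → {p, p̄}^⊥`. -/
def coordS (p : PeriodSpace n) : EuclideanSpace ℂ (Fin (n + 1)) →L[ℂ] CVec n :=
  (exists_coords p.rep p.isPosNull_rep).choose

/-- The orthogonal projection to `{p, p̄}^⊥` followed by the inverse of `coordS p`. -/
def coordT (p : PeriodSpace n) : CVec n →L[ℂ] EuclideanSpace ℂ (Fin (n + 1)) :=
  (exists_coords p.rep p.isPosNull_rep).choose_spec.choose

theorem coords_spec (p : PeriodSpace n) :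
    (∀ e, coordT p (coordS p e) = e) ∧ (∀ e, form n (coordS p e) p.rep = 0) ∧
    (∀ e, form n (coordS p e) (star p.rep) = 0) ∧
    ∀ v, v = (form n v (star p.rep) / form n p.rep (star p.rep)) • p.rep
        + (form n v p.rep / form n p.rep (star p.rep)) • star p.rep + coordS p (coordT p v) :=
  (exists_coords p.rep p.isPosNull_rep).choose_spec.choose_spec

/-- The holomorphic parametrization of the null vectors `v` with `⟨v, p̄⟩ = 1` inverse to the
projection to `{p, p̄}^⊥` (stereographic projection of the quadric). -/
def param (p : PeriodSpace n) (e : EuclideanSpace ℂ (Fin (n + 1))) : CVec n :=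
  (form n p.rep (star p.rep))⁻¹ • p.rep
    - (form n (coordS p e) (coordS p e) / 2) • star p.rep + coordS p e

/-- The affine coordinate map `[v] ↦ T v / ⟨v, p̄⟩`. -/
def coord (p : PeriodSpace n) (v : CVec n) : EuclideanSpace ℂ (Fin (n + 1)) :=
  (form n v (star p.rep))⁻¹ • coordT p v

theorem coord_smul (p : PeriodSpace n) (v : CVec n) {a : ℂ} (ha : a ≠ 0) :
    coord p (a • v) = coord p v := by
  simp only [coord, map_smul, LinearMap.smul_apply, smul_eq_mul, smul_smul, mul_inv]
  congr 1
  field_simp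

theorem form_rep_ne_zero (p : PeriodSpace n) : form n p.rep (star p.rep) ≠ 0 := fun h => by
  have := p.isPosNull_rep.2
  rw [h] at this
  simp at this

theorem form_star_rep (p : PeriodSpace n) : form n (star p.rep) (star p.rep) = 0 := by
  rw [form_star, p.isPosNull_rep.1, star_zero]

theorem form_param (p : PeriodSpace n) (e : EuclideanSpace ℂ (Fin (n + 1))) :
    form n (param p e) (star p.rep) = 1 := by
  simp only [param, map_add, map_sub, map_smul, LinearMap.add_apply, LinearMap.sub_apply,
    LinearMap.smul_apply, smul_eq_mul, form_star_rep, (coords_spec p).2.2.1, mul_zero, sub_zero,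
    add_zero]
  exact inv_mul_cancel₀ (form_rep_ne_zero p)

theorem form_param_param (p : PeriodSpace n) (e : EuclideanSpace ℂ (Fin (n + 1))) :
    form n (param p e) (param p e) = 0 := by
  have h1 : form n p.rep (coordS p e) = 0 := by rw [form_comm, (coords_spec p).2.1]
  have h2 : form n (star p.rep) (coordS p e) = 0 := by rw [form_comm, (coords_spec p).2.2.1]
  have h3 : form n (star p.rep) p.rep = form n p.rep (star p.rep) := form_comm _ _
  have h0 := form_rep_ne_zero p
  simp only [param, map_add, map_sub, map_smul, LinearMap.add_apply, LinearMap.sub_apply,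
    LinearMap.smul_apply, smul_eq_mul, form_star_rep, (coords_spec p).2.2.1, (coords_spec p).2.1,
    h1, h2, h3, p.isPosNull_rep.1]
  field_simp
  ring

theorem coordT_rep (p : PeriodSpace n) : coordT p p.rep = 0 := by
  have h := (coords_spec p).2.2.2 p.rep
  rw [div_self (form_rep_ne_zero p), p.isPosNull_rep.1, zero_div, zero_smul, one_smul, add_zero]
    at h
  have h2 : coordS p (coordT p p.rep) = 0 := by simpa using h
  rw [← (coords_spec p).1 (coordT p p.rep), h2, map_zero]

theorem coordT_star_rep (p : PeriodSpace n) : coordT p (star p.rep) = 0 := by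
  have h := (coords_spec p).2.2.2 (star p.rep)
  rw [form_star_rep, form_comm (star p.rep) p.rep, div_self (form_rep_ne_zero p), zero_div, zero_smul, one_smul,
    zero_add] at h
  have h2 : coordS p (coordT p (star p.rep)) = 0 := by simpa using h
  rw [← (coords_spec p).1 (coordT p (star p.rep)), h2, map_zero]

theorem coord_param (p : PeriodSpace n) (e : EuclideanSpace ℂ (Fin (n + 1))) :
    coord p (param p e) = e := by
  rw [coord, form_param, inv_one, one_smul, param]
  simp only [map_add, map_sub, map_smul, coordT_rep, coordT_star_rep, smul_zero, sub_zero,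
    zero_add, (coords_spec p).1]

theorem param_coord (p : PeriodSpace n) {v : CVec n} (hv : form n v v = 0)
    (h : form n v (star p.rep) ≠ 0) :
    param p (coord p v) = (form n v (star p.rep))⁻¹ • v := by
  set u : CVec n := (form n v (star p.rep))⁻¹ • v with hu
  have hu1 : form n u (star p.rep) = 1 := by
    rw [hu, map_smul, LinearMap.smul_apply, smul_eq_mul, inv_mul_cancel₀ h]
  have hu0 : form n u u = 0 := by simp [hu, hv]
  have hc : coord p v = coordT p u := by rw [coord, hu, map_smul]
  have h0 := form_rep_ne_zero p
  have hdec := (coords_spec p).2.2.2 u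
  rw [hu1] at hdec
  rw [hc, param]
  set s := coordS p (coordT p u) with hs
  have h1 : form n p.rep s = 0 := by rw [form_comm, (coords_spec p).2.1]
  have h2 : form n (star p.rep) s = 0 := by rw [form_comm, (coords_spec p).2.2.1]
  have h1' : form n s p.rep = 0 := (coords_spec p).2.1 _
  have h2' : form n s (star p.rep) = 0 := (coords_spec p).2.2.1 _
  have h3 : form n (star p.rep) p.rep = form n p.rep (star p.rep) := form_comm _ _
  set b := form n u p.rep / form n p.rep (star p.rep) with hb
  have key : form n s s / 2 = -b := by
    rw [hdec] at hu0
    simp only [map_add, map_smul, LinearMap.add_apply, LinearMap.smul_apply, smul_eq_mul,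
      form_star_rep, h1, h2, h1', h2', h3, p.isPosNull_rep.1] at hu0
    have h4 : 1 / form n p.rep (star p.rep) * form n p.rep (star p.rep) = 1 := by
      rw [one_div, inv_mul_cancel₀ h0]
    linear_combination (1 / 2 : ℂ) * hu0 - b * h4
  rw [key]
  conv_rhs => rw [hdec]
  rw [one_div, neg_smul, sub_neg_eq_add]

theorem contDiff_form : ContDiff ℂ ω (fun x : CVec n × CVec n => form n x.1 x.2) := by
  simp only [form_apply]
  fun_prop

theorem contDiff_param (p : PeriodSpace n) : ContDiff ℂ ω (param p) := by
  have hS : ContDiff ℂ ω (coordS p) := (coordS p).contDiff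
  have hB : ContDiff ℂ ω (fun e => form n (coordS p e) (coordS p e)) :=
    ContDiff.comp (g := fun x : CVec n × CVec n => form n x.1 x.2)
      (f := fun e => (coordS p e, coordS p e)) contDiff_form (hS.prodMk hS)
  exact (contDiff_const.sub ((hB.div_const 2).smul contDiff_const)).add hS

theorem contDiffAt_coord (p : PeriodSpace n) {v : CVec n} (h : form n v (star p.rep) ≠ 0) :
    ContDiffAt ℂ ω (coord p) v := by
  have hB : ContDiff ℂ ω (fun v => form n v (star p.rep)) :=
    contDiff_form.comp (contDiff_id.prodMk contDiff_const)
  exact (hB.contDiffAt.inv h).smul (coordT p).contDiff.contDiffAt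

theorem isOpen_pos : IsOpen {v : CVec n | 0 < (form n v (star v)).re} := by
  refine isOpen_lt continuous_const (Complex.continuous_re.comp ?_)
  exact contDiff_form.continuous.comp (continuous_id.prodMk continuous_star)

open Classical in
/-- The chart of the period space around `p`: stereographic projection of the quadric. -/
def chart (p : PeriodSpace n) :
    OpenPartialHomeomorph (PeriodSpace n) (EuclideanSpace ℂ (Fin (n + 1))) where
  toFun q := coord p q.rep
  invFun e := if h : IsPosNull (param p e) then mk (param p e) h else p
  source := {q | form n q.rep (star p.rep) ≠ 0}
  target := {e | 0 < (form n (param p e) (star (param p e))).re}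
  map_source' := by
    intro q hq
    change 0 < (form n (param p (coord p q.rep)) (star (param p (coord p q.rep)))).re
    rw [param_coord p q.isPosNull_rep.1 hq]
    exact (q.isPosNull_rep.smul (inv_ne_zero hq)).2
  map_target' := by
    intro e he
    have h : IsPosNull (param p e) := ⟨form_param_param p e, he⟩
    rw [dif_pos h]
    obtain ⟨a, ha, h2⟩ := exists_rep_mk _ h
    change form n (mk _ h).rep _ ≠ 0
    rw [h2, map_smul, LinearMap.smul_apply, form_param]
    simpa using ha
  left_inv' := by
    intro q hq
    have h1 := param_coord p q.isPosNull_rep.1 hq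
    have h : IsPosNull (param p (coord p q.rep)) := by
      rw [h1]; exact q.isPosNull_rep.smul (inv_ne_zero hq)
    rw [dif_pos h]
    conv_rhs => rw [← q.mk_rep]
    exact mk_eq_mk _ _ h1.symm
  right_inv' := by
    intro e he
    have h : IsPosNull (param p e) := ⟨form_param_param p e, he⟩
    rw [dif_pos h]
    obtain ⟨a, ha, h2⟩ := exists_rep_mk _ h
    rw [h2, coord_smul _ _ ha, coord_param]
  open_source := by
    have : IsOpen {q : ℙ ℂ (CVec n) | form n q.rep (star p.rep) ≠ 0} := by
      rw [← isOpenQuotientMap_mk'.isQuotientMap.isOpen_preimage]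
      have h2 : (Projectivization.mk' ℂ : {v : CVec n // v ≠ 0} → ℙ ℂ (CVec n)) ⁻¹'
          {q : ℙ ℂ (CVec n) | form n q.rep (star p.rep) ≠ 0} =
          {v | form n v.1 (star p.rep) ≠ 0} := by
        ext v
        obtain ⟨a, ha⟩ := Projectivization.exists_smul_eq_mk_rep ℂ v.1 v.2
        change form n (Projectivization.mk ℂ v.1 v.2).rep _ ≠ 0 ↔ _
        rw [← ha, Units.smul_def, map_smul, LinearMap.smul_apply]
        simp
      rw [h2]
      exact isOpen_ne_fun (contDiff_form.continuous.comp
        (continuous_subtype_val.prodMk continuous_const)) continuous_const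
    exact this.preimage continuous_subtype_val
  open_target := isOpen_pos.preimage (contDiff_param p).continuous
  continuousOn_toFun := by
    intro q hq
    apply ContinuousAt.continuousWithinAt
    have h1 : ContinuousAt (fun x : ℙ ℂ (CVec n) => coord p x.rep)
        (Projectivization.mk' ℂ ⟨q.rep, q.isPosNull_rep.ne_zero⟩) := by
      rw [← isOpenQuotientMap_mk'.continuousAt_comp_iff]
      have h2 : (fun x : ℙ ℂ (CVec n) => coord p x.rep) ∘ Projectivization.mk' ℂ =
          fun v : {v : CVec n // v ≠ 0} => coord p v.1 := by
        funext v
        obtain ⟨a, ha⟩ := Projectivization.exists_smul_eq_mk_rep ℂ v.1 v.2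
        change coord p (Projectivization.mk ℂ v.1 v.2).rep = _
        rw [← ha, Units.smul_def, coord_smul _ _ a.ne_zero]
      rw [h2]
      exact (contDiffAt_coord p hq).continuousAt.comp (f := Subtype.val)
        continuous_subtype_val.continuousAt
    have h3 : Projectivization.mk' ℂ ⟨q.rep, q.isPosNull_rep.ne_zero⟩ = q.1 := q.1.mk_rep
    rw [h3] at h1
    exact h1.comp (f := Subtype.val) continuous_subtype_val.continuousAt
  continuousOn_invFun := by
    have h1 : ContinuousOn (fun e => if h : IsPosNull (param p e) then mk (param p e) h else p)
        {e | IsPosNull (param p e)} := by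
      rw [continuousOn_iff_continuous_domRestrict]
      refine Continuous.congr (f := fun e : {e | IsPosNull (param p e)} =>
        mk (param p e.1) e.2) ?_ ?_
      · refine Continuous.subtype_mk ?_ _
        exact isOpenQuotientMap_mk'.continuous.comp (Continuous.subtype_mk
          ((contDiff_param p).continuous.comp continuous_subtype_val)
          fun e => IsPosNull.ne_zero e.2)
      · intro e
        exact (dif_pos e.2).symm
    exact h1.mono fun e he => ⟨form_param_param p e, he⟩

theorem chart_symm_apply (p : PeriodSpace n) {e : EuclideanSpace ℂ (Fin (n + 1))}
    (h : IsPosNull (param p e)) : (chart p).symm e = mk (param p e) h :=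
  dif_pos h

instance : ChartedSpace (EuclideanSpace ℂ (Fin (n + 1))) (PeriodSpace n) where
  atlas := Set.range chart
  chartAt := chart
  mem_chart_source p := form_rep_ne_zero p
  chart_mem_atlas p := ⟨p, rfl⟩

/-- The charts are holomorphically compatible: the period space is a complex manifold of
dimension `n + 1`. -/
instance : IsManifold 𝓘(ℂ, EuclideanSpace ℂ (Fin (n + 1))) ω (PeriodSpace n) := by
  apply isManifold_of_contDiffOn
  rintro _ _ ⟨p, rfl⟩ ⟨q, rfl⟩ e he
  have he' : e ∈ (chart p).target ∧ (chart p).symm e ∈ (chart q).source := by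
    simpa [OpenPartialHomeomorph.trans_source] using he
  have hpos : ∀ x ∈ (chart p).target, IsPosNull (param p x) :=
    fun x hx => ⟨form_param_param p x, hx⟩
  have heq : ∀ x ∈ (chart p).target, (chart q) ((chart p).symm x) = coord q (param p x) := by
    intro x hx
    obtain ⟨a, ha, h2⟩ := exists_rep_mk _ (hpos x hx)
    rw [chart_symm_apply p (hpos x hx)]
    change coord q (mk _ _).rep = _
    rw [h2, coord_smul _ _ ha]
  have hne : form n (param p e) (star q.rep) ≠ 0 := by
    have h1 := he'.2
    rw [chart_symm_apply p (hpos e he'.1)] at h1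
    obtain ⟨a, ha, h2⟩ := exists_rep_mk _ (hpos e he'.1)
    change form n (mk _ _).rep _ ≠ 0 at h1
    rw [h2, map_smul, LinearMap.smul_apply] at h1
    exact right_ne_zero_of_mul h1
  have hcd : ContDiffAt ℂ ω (fun x => coord q (param p x)) e :=
    (contDiffAt_coord q hne).comp e (contDiff_param p).contDiffAt
  refine (hcd.congr_of_eventuallyEq ?_).contDiffWithinAt
  filter_upwards [(chart p).open_target.mem_nhds he'.1] with x hx
  exact heq x hx

end PeriodSpace

end

/-
Let `π` be the projection of `ℝ^{3,n} ⊗ ℂ` to a positive definite plane. Its kernel has signature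
`(1, n)` and so contains no positive null vector, hence `[v] ↦ ‖v‖ / ‖π v‖` is a continuous function
on the period space, and its pullback to a compact `X` attains a maximum at some `x`. By the maximum
modulus principle, at such a point every tangent direction in which `[π v] ∈ ℙ¹` is stationary is
one in which `[v]` itself is stationary. The differential of `X → Per` at `x` therefore has rank at
most `dim ℙ¹ = 1`; for an immersion this rank is `dim X`.
-/

theorem finrank_range_le_of_ker_le {K V V₁ V₂ : Type*} [DivisionRing K] [AddCommGroup V]
    [Module K V] [AddCommGroup V₁] [Module K V₁] [AddCommGroup V₂] [Module K V₂]
    {f : V →ₗ[K] V₁} {g : V →ₗ[K] V₂} [FiniteDimensional K V₁]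
    (h : LinearMap.ker f ≤ LinearMap.ker g) :
    Module.finrank K (LinearMap.range g) ≤ Module.finrank K V₁ := by
  have : FiniteDimensional K (V ⧸ LinearMap.ker f) := f.quotKerEquivRange.symm.finiteDimensional
  calc Module.finrank K (LinearMap.range g)
      = Module.finrank K (LinearMap.range ((LinearMap.ker f).liftQ g h)) := by
        rw [Submodule.range_liftQ]
    _ ≤ Module.finrank K (V ⧸ LinearMap.ker f) := LinearMap.finrank_range_le _
    _ = Module.finrank K (LinearMap.range f) := f.quotKerEquivRange.finrank_eq
    _ ≤ Module.finrank K V₁ := Submodule.finrank_le _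

theorem eventually_norm_lt_norm_of_hasDerivAt {𝕜 E F : Type*} [NontriviallyNormedField 𝕜]
    [NormedAddCommGroup E] [NormedSpace 𝕜 E] [NormedAddCommGroup F] [NormedSpace 𝕜 F]
    {f : 𝕜 → E} {g : 𝕜 → F} {f' : E} {g' : F} {x : 𝕜}
    (hf : HasDerivAt f f' x) (hg : HasDerivAt g g' x) (hfx : f x = 0) (hgx : g x = 0)
    (hlt : ‖f'‖ < ‖g'‖) : ∀ᶠ z in 𝓝[≠] x, ‖f z‖ < ‖g z‖ := by
  filter_upwards [hf.tendsto_slope.norm.eventually_lt hg.tendsto_slope.norm hlt] with z hz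
  simp only [slope, vsub_eq_sub, hfx, hgx, sub_zero, norm_smul] at hz
  exact lt_of_mul_lt_mul_left hz (norm_nonneg _)

theorem frequently_norm_le_norm_of_differentiableAt {a b : ℂ → ℂ} {x : ℂ}
    (ha : ∀ᶠ z in 𝓝 x, DifferentiableAt ℂ a z) (hb : ∀ᶠ z in 𝓝 x, DifferentiableAt ℂ b z)
    (hbx : b x ≠ 0) (hle : ‖b x‖ ≤ ‖a x‖) : ∃ᶠ z in 𝓝[≠] x, ‖b z‖ ≤ ‖a z‖ := by
  intro hlt
  have hquot_lt : ∀ᶠ z in 𝓝[≠] x, ‖a z / b z‖ < 1 := by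
    filter_upwards [hlt] with z hz
    rw [norm_div]
    exact (div_lt_one ((norm_nonneg _).trans_lt (not_le.1 hz))).2 (not_le.1 hz)
  have hquot_x : 1 ≤ ‖a x / b x‖ := by
    rwa [norm_div, one_le_div (norm_pos_iff.2 hbx)]
  have hdiff : ∀ᶠ z in 𝓝 x, DifferentiableAt ℂ (fun z => a z / b z) z := by
    filter_upwards [ha, hb, hb.self_of_nhds.continuousAt.eventually_ne hbx] with z haz hbz hz
    exact haz.div hbz hz
  have hmax : IsLocalMax (norm ∘ fun z => a z / b z) x := by
    filter_upwards [eventually_nhdsWithin_iff.1 hquot_lt] with z hz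
    rcases eq_or_ne z x with rfl | hzx
    · exact le_rfl
    · exact (hz hzx).le.trans hquot_x
  have hconst := (Complex.eventually_eq_of_isLocalMax_norm hdiff hmax).filter_mono
    (nhdsWithin_le_nhds (s := {x}ᶜ))
  obtain ⟨z, hz, hzx⟩ := (hquot_lt.and hconst).exists
  exact hquot_x.not_gt (hzx ▸ hz)

section OrthogonalProjection

variable {𝕜 V W : Type*} [RCLike 𝕜] [NormedAddCommGroup V] [InnerProductSpace 𝕜 V]
  [NormedAddCommGroup W] [InnerProductSpace 𝕜 W]

theorem norm_inner_eq_norm_mul_norm_starProjection (a x : V) :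
    ‖inner 𝕜 a x‖ = ‖a‖ * ‖(Submodule.span 𝕜 {a}).starProjection x‖ := by
  have h := congrArg norm (Submodule.smul_starProjection_singleton 𝕜 (v := a) x)
  simp only [norm_smul, RCLike.norm_ofReal, abs_pow, abs_norm] at h
  rcases eq_or_ne a 0 with rfl | ha
  · simp
  · exact mul_right_cancel₀ (norm_ne_zero_iff.2 ha) (by linear_combination -h)

theorem norm_inner_lt_norm_inner_of_norm_le {a x : V} {b y : W} (hab : ‖a‖ = ‖b‖) (hb : b ≠ 0)
    (hxy : ‖x‖ ≤ ‖y‖)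
    (horth : ‖(Submodule.span 𝕜 {b})ᗮ.starProjection y‖ <
      ‖(Submodule.span 𝕜 {a})ᗮ.starProjection x‖) :
    ‖inner 𝕜 a x‖ < ‖inner 𝕜 b y‖ := by
  rw [norm_inner_eq_norm_mul_norm_starProjection, norm_inner_eq_norm_mul_norm_starProjection, hab]
  refine mul_lt_mul_of_pos_left ?_ (norm_pos_iff.2 hb)
  have hx_pyth := Submodule.norm_sq_eq_add_norm_sq_starProjection x (Submodule.span 𝕜 {a})
  have hy_pyth := Submodule.norm_sq_eq_add_norm_sq_starProjection y (Submodule.span 𝕜 {b})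
  have hxy_sq := pow_le_pow_left₀ (norm_nonneg _) hxy 2
  have horth_sq := pow_lt_pow_left₀ horth (norm_nonneg _) two_ne_zero
  exact lt_of_pow_lt_pow_left₀ 2 (norm_nonneg _) (by linarith)

theorem eventually_norm_starProjection_orthogonal_lt_of_hasDerivAt {v : 𝕜 → V} {u : 𝕜 → W}
    {v' : V} {u' : W} {x : 𝕜} (hv : HasDerivAt v v' x) (hu : HasDerivAt u u' x)
    (hu' : u' ∈ Submodule.span 𝕜 {u x}) (hv' : v' ∉ Submodule.span 𝕜 {v x}) :
    ∀ᶠ z in 𝓝[≠] x, ‖(Submodule.span 𝕜 {u x})ᗮ.starProjection (u z)‖ <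
      ‖(Submodule.span 𝕜 {v x})ᗮ.starProjection (v z)‖ := by
  have hproj_v {w : V} :
      (Submodule.span 𝕜 {v x})ᗮ.starProjection w = 0 ↔ w ∈ Submodule.span 𝕜 {v x} := by
    rw [Submodule.starProjection_apply_eq_zero_iff, Submodule.orthogonal_orthogonal]
  have hproj_u {w : W} :
      (Submodule.span 𝕜 {u x})ᗮ.starProjection w = 0 ↔ w ∈ Submodule.span 𝕜 {u x} := by
    rw [Submodule.starProjection_apply_eq_zero_iff, Submodule.orthogonal_orthogonal]
  refine eventually_norm_lt_norm_of_hasDerivAt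
    (((Submodule.span 𝕜 {u x})ᗮ.starProjection).hasFDerivAt.comp_hasDerivAt x hu)
    (((Submodule.span 𝕜 {v x})ᗮ.starProjection).hasFDerivAt.comp_hasDerivAt x hv)
    (hproj_u.2 (Submodule.mem_span_singleton_self _))
    (hproj_v.2 (Submodule.mem_span_singleton_self _)) ?_
  rw [hproj_u.2 hu', norm_zero, norm_pos_iff, Ne, hproj_v]
  exact hv'

end OrthogonalProjection

section HolomorphicMaps

variable {E V W : Type*} [NormedAddCommGroup E] [NormedSpace ℂ E]
  [NormedAddCommGroup V] [InnerProductSpace ℂ V] [NormedAddCommGroup W] [InnerProductSpace ℂ W]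

/- If `v'` were not a multiple of `v x`, the component of `v z` orthogonal to `v x` would dominate
that of `u z` orthogonal to `u x` near `x`. As `‖v‖ ≤ ‖u‖`, the components along `v x` and `u x`
would compare strictly the other way round, contradicting the maximum modulus principle. -/
theorem deriv_mem_span_of_norm_le {v : ℂ → V} {u : ℂ → W} {x : ℂ}
    (hv : ∀ᶠ z in 𝓝 x, DifferentiableAt ℂ v z) (hu : ∀ᶠ z in 𝓝 x, DifferentiableAt ℂ u z)
    (hux : u x ≠ 0) (hle : ∀ᶠ z in 𝓝 x, ‖v z‖ ≤ ‖u z‖) (heq : ‖v x‖ = ‖u x‖)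
    (hspan : deriv u x ∈ Submodule.span ℂ {u x}) :
    deriv v x ∈ Submodule.span ℂ {v x} := by
  by_contra hnot
  have hinner : ∀ᶠ z in 𝓝[≠] x, ‖inner ℂ (v x) (v z)‖ < ‖inner ℂ (u x) (u z)‖ := by
    filter_upwards [eventually_norm_starProjection_orthogonal_lt_of_hasDerivAt
      hv.self_of_nhds.hasDerivAt hu.self_of_nhds.hasDerivAt hspan hnot,
      hle.filter_mono nhdsWithin_le_nhds] with z horth hvu
    exact norm_inner_lt_norm_inner_of_norm_le heq hux hvu horth
  have hfreq : ∃ᶠ z in 𝓝[≠] x, ‖inner ℂ (u x) (u z)‖ ≤ ‖inner ℂ (v x) (v z)‖ :=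
    frequently_norm_le_norm_of_differentiableAt
      (hv.mono fun z hz => (innerSL ℂ (v x)).differentiableAt.comp z hz)
      (hu.mono fun z hz => (innerSL ℂ (u x)).differentiableAt.comp z hz)
      (inner_self_ne_zero.2 hux)
      (by simp only [inner_self_eq_norm_sq_to_K, heq, le_refl])
  exact hfreq (hinner.mono fun z hz => hz.not_ge)

theorem deriv_mem_span_of_isLocalMax_norm_div {v : ℂ → V} {u : ℂ → W} {x : ℂ}
    (hv : ∀ᶠ z in 𝓝 x, DifferentiableAt ℂ v z) (hu : ∀ᶠ z in 𝓝 x, DifferentiableAt ℂ u z)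
    (hvx : v x ≠ 0) (hux : u x ≠ 0) (hmax : IsLocalMax (fun z => ‖v z‖ / ‖u z‖) x)
    (hspan : deriv u x ∈ Submodule.span ℂ {u x}) :
    deriv v x ∈ Submodule.span ℂ {v x} := by
  let c : ℝ := ‖v x‖ / ‖u x‖
  have hc : 0 < c := div_pos (norm_pos_iff.2 hvx) (norm_pos_iff.2 hux)
  have hc_ne : (c : ℂ) ≠ 0 := Complex.ofReal_ne_zero.2 hc.ne'
  have hnorm (z : ℂ) : ‖(c : ℂ) • u z‖ = c * ‖u z‖ := by
    rw [norm_smul, Complex.norm_of_nonneg hc.le]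
  refine deriv_mem_span_of_norm_le (u := fun z => (c : ℂ) • u z) hv
    (hu.mono fun z hz => hz.const_smul _) (smul_ne_zero hc_ne hux) ?_ ?_ ?_
  · filter_upwards [hmax, hu.self_of_nhds.continuousAt.eventually_ne hux] with z hz huz
    rw [hnorm]
    exact (div_le_iff₀ (norm_pos_iff.2 huz)).1 hz
  · rw [hnorm, div_mul_cancel₀ _ (norm_ne_zero_iff.2 hux)]
  · rw [deriv_fun_const_smul _ hu.self_of_nhds,
      Submodule.span_singleton_smul_eq (IsUnit.mk0 _ hc_ne)]
    exact Submodule.smul_mem _ _ hspan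

theorem fderiv_mem_span_of_isLocalMax_norm_div {v : E → V} {u : E → W} {y : E}
    (hv : ∀ᶠ z in 𝓝 y, DifferentiableAt ℂ v z) (hu : ∀ᶠ z in 𝓝 y, DifferentiableAt ℂ u z)
    (hvy : v y ≠ 0) (huy : u y ≠ 0) (hmax : IsLocalMax (fun z => ‖v z‖ / ‖u z‖) y) {w : E}
    (hspan : fderiv ℂ u y w ∈ Submodule.span ℂ {u y}) :
    fderiv ℂ v y w ∈ Submodule.span ℂ {v y} := by
  let line : ℂ → E := fun t => y + t • w
  have hline_diff : Differentiable ℂ line := by fun_prop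
  have hline_zero : line 0 = y := by simp [line]
  have hline : Filter.Tendsto line (𝓝 0) (𝓝 y) := hline_zero ▸ hline_diff.continuous.tendsto 0
  have hmem := deriv_mem_span_of_isLocalMax_norm_div (v := v ∘ line) (u := u ∘ line) (x := 0)
    ((hline.eventually hv).mono fun t ht => ht.comp t (hline_diff t))
    ((hline.eventually hu).mono fun t ht => ht.comp t (hline_diff t))
  simp only [IsLocalMax, IsMaxFilter, Function.comp_apply, hline_zero] at hmem
  rw [← hv.self_of_nhds.lineDeriv_eq_fderiv]
  rw [← hu.self_of_nhds.lineDeriv_eq_fderiv] at hspan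
  exact hmem hvy huy (hline.eventually hmax) hspan

theorem finrank_range_comp_fderiv_lt_of_isLocalMax_norm_div {G : Type*} [AddCommGroup G]
    [Module ℂ G] [FiniteDimensional ℂ W] {v : E → V} {u : E → W} {y : E}
    (hv : ∀ᶠ z in 𝓝 y, DifferentiableAt ℂ v z) (hu : ∀ᶠ z in 𝓝 y, DifferentiableAt ℂ u z)
    (hvy : v y ≠ 0) (huy : u y ≠ 0) (hmax : IsLocalMax (fun z => ‖v z‖ / ‖u z‖) y)
    {T : V →ₗ[ℂ] G} (hT : T (v y) = 0) :
    Module.finrank ℂ (LinearMap.range (T ∘ₗ (fderiv ℂ v y).toLinearMap)) < Module.finrank ℂ W := by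
  let uy := Submodule.span ℂ {u y}
  have hker : LinearMap.ker (uy.mkQ ∘ₗ (fderiv ℂ u y).toLinearMap) ≤
      LinearMap.ker (T ∘ₗ (fderiv ℂ v y).toLinearMap) := by
    intro w hw
    have hu_stationary : fderiv ℂ u y w ∈ uy := (Submodule.Quotient.mk_eq_zero uy).1 hw
    obtain ⟨c, hc⟩ := Submodule.mem_span_singleton.1
      (fderiv_mem_span_of_isLocalMax_norm_div hv hu hvy huy hmax hu_stationary)
    change T (fderiv ℂ v y w) = 0
    rw [← hc, map_smul, hT, smul_zero]
  have hquot := Submodule.finrank_quotient_add_finrank uy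
  rw [finrank_span_singleton huy] at hquot
  have := finrank_range_le_of_ker_le hker
  omega

end HolomorphicMaps

theorem injective_mfderiv_of_isImmersionAt {𝕜 E E' H H' M N : Type*} [NontriviallyNormedField 𝕜]
    [NormedAddCommGroup E] [NormedSpace 𝕜 E] [NormedAddCommGroup E'] [NormedSpace 𝕜 E']
    [TopologicalSpace H] {I : ModelWithCorners 𝕜 E H}
    [TopologicalSpace H'] {J : ModelWithCorners 𝕜 E' H'}
    [TopologicalSpace M] [ChartedSpace H M] [TopologicalSpace N] [ChartedSpace H' N]
    {n : ℕ∞ω} (hn : n ≠ 0) {f : M → N} {x : M} [IsManifold I n M] [IsManifold J n N]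
    (hf : Manifold.IsImmersionAt I J n f x) : Function.Injective (mfderiv I J f x) := by
  let r (q : N) : E := (hf.equiv.symm (hf.codChart.extend J q)).1
  have hφ : hf.domChart.MDifferentiable I I :=
    ⟨(contMDiffOn_of_mem_maximalAtlas hf.domChart_mem_maximalAtlas).mdifferentiableOn hn,
      (contMDiffOn_symm_of_mem_maximalAtlas hf.domChart_mem_maximalAtlas).mdifferentiableOn hn⟩
  have hleft : r ∘ f =ᶠ[𝓝 x] I ∘ hf.domChart := by
    filter_upwards [hf.domChart.open_source.mem_nhds hf.mem_domChart_source] with z hz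
    have hwritten := hf.writtenInCharts
      ((hf.domChart.extend I).map_source (by rwa [hf.domChart.extend_source]))
    simp only [Function.comp_apply, hf.domChart.extend_left_inv hz] at hwritten
    simp only [r, Function.comp_apply, hwritten, hf.equiv.symm_apply_apply]
    rfl
  have hr : MDifferentiableAt J 𝓘(𝕜, E) r (f x) := by
    have hψ := (hf.codChart.contMDiffAt_extend hf.codChart_mem_maximalAtlas
      hf.mem_codChart_source).mdifferentiableAt hn
    exact (((ContinuousLinearMap.fst 𝕜 E hf.complement).comp
      hf.equiv.symm.toContinuousLinearMap).mdifferentiableAt).comp (f x) hψ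
  have hfx : MDifferentiableAt I J f x := hf.contMDiffAt.mdifferentiableAt hn
  have hchart : HasMFDerivAt I 𝓘(𝕜, E) (I ∘ hf.domChart) x (mfderiv I I hf.domChart x) :=
    I.hasMFDerivAt.comp x (hφ.mdifferentiableAt hf.mem_domChart_source).hasMFDerivAt
  have hchain : (mfderiv J 𝓘(𝕜, E) r (f x)).comp (mfderiv I J f x) =
      mfderiv I I hf.domChart x := by
    rw [← mfderiv_comp x hr hfx, hleft.mfderiv_eq]
    exact hchart.mfderiv
  have hinj := hφ.mfderiv_injective hf.mem_domChart_source
  rw [← hchain] at hinj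
  exact Function.Injective.of_comp (f := mfderiv J 𝓘(𝕜, E) r (f x)) hinj

namespace PeriodSpace

variable {n : ℕ}

/-- The identity map from `CVec n` to Euclidean space, through which vectors are measured by their
Hermitian norm: `CVec n` itself carries the sup norm. -/
noncomputable def toEuclidean (n : ℕ) : CVec n ≃L[ℂ] EuclideanSpace ℂ (Fin 3 ⊕ Fin n) :=
  (EuclideanSpace.equiv (Fin 3 ⊕ Fin n) ℂ).symm

/-- The orthogonal projection of `ℝ^{3,n} ⊗ ℂ` to (the complexification of) a positive definite
plane, namely that of the last two positive coordinates. -/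
noncomputable def posPlaneProj (n : ℕ) : CVec n →L[ℂ] EuclideanSpace ℂ (Fin 2) :=
  (EuclideanSpace.equiv (Fin 2) ℂ).symm.toContinuousLinearMap ∘L
    ContinuousLinearMap.pi fun i => ContinuousLinearMap.proj (Sum.inl i.succ)

theorem IsPosNull.posPlaneProj_ne_zero {v : CVec n} (hv : IsPosNull v) :
    posPlaneProj n v ≠ 0 := by
  intro hproj
  have hv₁ : v (Sum.inl 1) = 0 := congrArg (fun w : EuclideanSpace ℂ (Fin 2) => w 0) hproj
  have hv₂ : v (Sum.inl 2) = 0 := congrArg (fun w : EuclideanSpace ℂ (Fin 2) => w 1) hproj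
  obtain ⟨hnull, hpos⟩ := hv
  rw [form_apply, Fin.sum_univ_three, hv₁, hv₂] at hnull hpos
  have hsq : v (Sum.inl 0) ^ 2 = ∑ j : Fin n, v (Sum.inr j) ^ 2 := by
    simp only [pow_two]
    linear_combination hnull
  have hle : ‖v (Sum.inl 0)‖ ^ 2 ≤ ∑ j : Fin n, ‖v (Sum.inr j)‖ ^ 2 := by
    rw [← norm_pow, hsq]
    exact (norm_sum_le _ _).trans_eq (by simp only [norm_pow])
  have hre (z : ℂ) : (z * star z).re = ‖z‖ ^ 2 := by
    rw [← starRingEnd_apply, Complex.mul_conj', ← Complex.ofReal_pow, Complex.ofReal_re]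
  simp only [Pi.star_apply, zero_mul, add_zero, Complex.sub_re, Complex.re_sum, hre] at hpos
  linarith

/-- The function `[v] ↦ ‖v‖ / ‖π v‖` on the period space, where `π` is the projection to a
positive definite plane. It is finite by `IsPosNull.posPlaneProj_ne_zero`. -/
noncomputable def normRatio (q : PeriodSpace n) : ℝ :=
  ‖toEuclidean n q.rep‖ / ‖posPlaneProj n q.rep‖

theorem normRatio_mk {v : CVec n} (hv : IsPosNull v) :
    normRatio (mk v hv) = ‖toEuclidean n v‖ / ‖posPlaneProj n v‖ := by
  obtain ⟨a, ha, hrep⟩ := exists_rep_mk v hv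
  rw [normRatio, hrep, map_smul, map_smul, norm_smul, norm_smul,
    mul_div_mul_left _ _ (norm_ne_zero_iff.2 ha)]

theorem isPosNull_param {p : PeriodSpace n} {e : EuclideanSpace ℂ (Fin (n + 1))}
    (he : e ∈ (chart p).target) : IsPosNull (param p e) :=
  ⟨form_param_param p e, he⟩

theorem normRatio_chart_symm {p : PeriodSpace n} {e : EuclideanSpace ℂ (Fin (n + 1))}
    (he : e ∈ (chart p).target) :
    normRatio ((chart p).symm e) = ‖toEuclidean n (param p e)‖ / ‖posPlaneProj n (param p e)‖ := by
  rw [chart_symm_apply p (isPosNull_param he), normRatio_mk]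

theorem chart_self (p : PeriodSpace n) : chart p p = 0 := by
  change coord p p.rep = 0
  rw [coord, coordT_rep, smul_zero]

theorem coordT_param (p : PeriodSpace n) (e : EuclideanSpace ℂ (Fin (n + 1))) :
    coordT p (param p e) = e := by
  simpa only [coord, form_param, inv_one, one_smul] using coord_param p e

theorem zero_mem_chart_target (p : PeriodSpace n) : 0 ∈ (chart p).target :=
  chart_self p ▸ (chart p).map_source (mem_chart_source _ p)

theorem continuous_normRatio : Continuous (normRatio (n := n)) := by
  refine continuous_iff_continuousAt.2 fun p => ?_
  have hp : p ∈ (chart p).source := mem_chart_source _ p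
  have hparam : Continuous (param p) := (contDiff_param p).continuous
  have hratio : ContinuousAt
      (fun e => ‖toEuclidean n (param p e)‖ / ‖posPlaneProj n (param p e)‖) (chart p p) :=
    ContinuousAt.div (by fun_prop) (by fun_prop)
      (norm_ne_zero_iff.2 (isPosNull_param ((chart p).map_source hp)).posPlaneProj_ne_zero)
  rw [(chart p).symm.continuousAt_iff_continuousAt_comp_right hp]
  refine hratio.congr ?_
  filter_upwards [(chart p).open_target.mem_nhds ((chart p).map_source hp)] with e he
  exact (normRatio_chart_symm he).symm

section LocalMax

open Module

variable {E : Type*} [NormedAddCommGroup E] [NormedSpace ℂ E]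

theorem finrank_range_fderiv_le_one_of_isLocalMax {p : PeriodSpace n}
    {F : E → EuclideanSpace ℂ (Fin (n + 1))} {y : E}
    (hF : ∀ᶠ z in 𝓝 y, DifferentiableAt ℂ F z) (hFy : F y = 0)
    (hmax : IsLocalMax (fun z => normRatio ((chart p).symm (F z))) y) :
    finrank ℂ (LinearMap.range (fderiv ℂ F y).toLinearMap) ≤ 1 := by
  let v (z : E) := toEuclidean n (param p (F z))
  let u (z : E) := posPlaneProj n (param p (F z))
  have htarget : ∀ᶠ z in 𝓝 y, F z ∈ (chart p).target :=
    hF.self_of_nhds.continuousAt.eventually_mem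
      ((chart p).open_target.mem_nhds (hFy ▸ zero_mem_chart_target p))
  have hpos : IsPosNull (param p (F y)) := isPosNull_param htarget.self_of_nhds
  have hparam : ∀ᶠ z in 𝓝 y, DifferentiableAt ℂ (fun z => param p (F z)) z :=
    hF.mono fun z hz => ((contDiff_param p).differentiable (by simp) _).comp z hz
  have hv : ∀ᶠ z in 𝓝 y, DifferentiableAt ℂ v z :=
    hparam.mono fun z hz => (toEuclidean n).differentiableAt.comp z hz
  have hu : ∀ᶠ z in 𝓝 y, DifferentiableAt ℂ u z :=
    hparam.mono fun z hz => (posPlaneProj n).differentiableAt.comp z hz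
  have hratio : IsLocalMax (fun z => ‖v z‖ / ‖u z‖) y :=
    hmax.congr (htarget.mono fun z hz => normRatio_chart_symm hz)
  let T : EuclideanSpace ℂ (Fin 3 ⊕ Fin n) →L[ℂ] EuclideanSpace ℂ (Fin (n + 1)) :=
    coordT p ∘L (toEuclidean n).symm.toContinuousLinearMap
  have hTv (z : E) : T (v z) = F z := by
    simp only [T, v, ContinuousLinearMap.comp_apply, ContinuousLinearEquiv.coe_coe,
      ContinuousLinearEquiv.symm_apply_apply, coordT_param]
  have hderiv : fderiv ℂ F y = T ∘L fderiv ℂ v y :=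
    (funext hTv : T ∘ v = F) ▸ (T.hasFDerivAt.comp y hv.self_of_nhds.hasFDerivAt).fderiv
  have hlt := finrank_range_comp_fderiv_lt_of_isLocalMax_norm_div hv hu
    ((toEuclidean n).map_ne_zero_iff.2 hpos.ne_zero) hpos.posPlaneProj_ne_zero hratio
    (T := T.toLinearMap) ((hTv y).trans hFy)
  rw [finrank_euclideanSpace_fin] at hlt
  rw [hderiv]
  exact Nat.lt_succ_iff.1 hlt

theorem finrank_range_mfderiv_le_one_of_isLocalMax {H X : Type*} [TopologicalSpace H]
    {I : ModelWithCorners ℂ E H} [I.Boundaryless] [TopologicalSpace X] [ChartedSpace H X]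
    {f : X → PeriodSpace n} {x : X}
    (hf : ContMDiffAt I 𝓘(ℂ, EuclideanSpace ℂ (Fin (n + 1))) 1 f x)
    (hmax : IsLocalMax (normRatio ∘ f) x) :
    finrank ℂ (LinearMap.range
      (mfderiv I 𝓘(ℂ, EuclideanSpace ℂ (Fin (n + 1))) f x).toLinearMap) ≤ 1 := by
  let y := extChartAt I x x
  let F (z : E) := chart (f x) (f ((extChartAt I x).symm z))
  have hsymm_y : (extChartAt I x).symm y = x := extChartAt_to_inv x
  have hsymm : Filter.Tendsto (extChartAt I x).symm (𝓝 y) (𝓝 x) := by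
    simpa only [ContinuousAt, extChartAt_to_inv] using continuousAt_extChartAt_symm (I := I) x
  have hF : ContDiffAt ℂ 1 F y := by
    have hwithin := (contMDiffAt_iff.1 hf).2
    rwa [I.range_eq_univ, contDiffWithinAt_univ] at hwithin
  have hFy : F y = 0 := by
    simp only [F, hsymm_y, chart_self]
  have hf_eq : ∀ᶠ z in 𝓝 y, (chart (f x)).symm (F z) = f ((extChartAt I x).symm z) :=
    (hsymm.eventually (hf.continuousAt.eventually_mem
      ((chart (f x)).open_source.mem_nhds (mem_chart_source _ (f x))))).mono
      fun z hz => (chart (f x)).left_inv hz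
  have hF_max : IsLocalMax (fun z => normRatio ((chart (f x)).symm (F z))) y := by
    filter_upwards [hsymm.eventually hmax, hf_eq] with z hz hfz
    rwa [hfz, hf_eq.self_of_nhds, hsymm_y]
  have hmfderiv : mfderiv I 𝓘(ℂ, EuclideanSpace ℂ (Fin (n + 1))) f x = fderiv ℂ F y := by
    rw [(hf.mdifferentiableAt one_ne_zero).mfderiv, I.range_eq_univ]
    exact congrFun (fderivWithin_univ (𝕜 := ℂ) (f := F)) y
  rw [hmfderiv]
  exact finrank_range_fderiv_le_one_of_isLocalMax (F := F)
    ((hF.eventually (by simp)).mono fun z hz => hz.differentiableAt one_ne_zero) hFy hF_max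

end LocalMax

end PeriodSpace

theorem mainTheorem3_general {n : ℕ} {E H X : Type*} [NormedAddCommGroup E] [NormedSpace ℂ E]
    [TopologicalSpace H] {I : ModelWithCorners ℂ E H} [I.Boundaryless]
    [TopologicalSpace X] [CompactSpace X] [Nonempty X] [ChartedSpace H X] {f : X → PeriodSpace n}
    (hf : ContMDiff I 𝓘(ℂ, EuclideanSpace ℂ (Fin (n + 1))) 1 f) :
    ∃ x, Module.finrank ℂ (LinearMap.range
      (mfderiv I 𝓘(ℂ, EuclideanSpace ℂ (Fin (n + 1))) f x).toLinearMap) ≤ 1 := by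
  obtain ⟨x, -, hx⟩ := isCompact_univ.exists_isMaxOn Set.univ_nonempty
    (PeriodSpace.continuous_normRatio.comp hf.continuous).continuousOn
  exact ⟨x, PeriodSpace.finrank_range_mfderiv_le_one_of_isLocalMax (hf x)
    (hx.isLocalMax Filter.univ_mem)⟩

/-- The period space `Gr₊₊(ℝ^{3,n})` contains no compact complex submanifold of dimension
greater than `1`: a nonempty compact complex manifold `X` of dimension `d` which is
holomorphically embedded in it has `d ≤ 1`. -/
theorem mainTheorem3 (n d : ℕ) (X : Type*) [TopologicalSpace X] [CompactSpace X] [Nonempty X]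
    [ChartedSpace (EuclideanSpace ℂ (Fin d)) X]
    [IsManifold 𝓘(ℂ, EuclideanSpace ℂ (Fin d)) ω X]
    (ι : X → PeriodSpace n)
    (hι : Manifold.IsSmoothEmbedding 𝓘(ℂ, EuclideanSpace ℂ (Fin d))
      𝓘(ℂ, EuclideanSpace ℂ (Fin (n + 1))) ω ι) :
    d ≤ 1 := by
  obtain ⟨x, hx⟩ := mainTheorem3_general (hι.contMDiff.of_le le_top)
  have hinj := injective_mfderiv_of_isImmersionAt (by simp) (hι.isImmersion.isImmersionAt x)
  rw [LinearMap.finrank_range_of_inj hinj] at hx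
  exact finrank_euclideanSpace_fin (𝕜 := ℂ) (n := d) ▸ hx
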